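/- A generalized topological space (gts) is a triple $(X,\mathrm{Op}_X,\mathrm{Cov}_X)$ in the sense of Delfs and Knebusch, with $\mathrm{Op}_X=\bigcup\mathrm{Cov}_X$; $\mathrm{Cl}_X$ is the family of complements of members of $\mathrm{Op}_X$, and $X_{top}$ is $X$ with the topology generated by $\mathrm{Op}_X$. A gts has a topological property *topologically* if $X_{top}$ has it, and is *weakly Hausdorff* if $X_{top}$ is Hausdorff. For a family $\mathcal O$ of sets, $\mathrm{EssFin}(\mathcal O)$ is the collection of all $\mathcal U\subseteq\mathcal O$ such that $\bigcup\mathcal U=\bigcup\mathcal V$ for some finite $\mathcal V\subseteq\mathcal U$; $X$ is *small* if $\mathrm{Cov}_X=\mathrm{EssFin}(\mathrm{Op}_X)$. $X$ is *weakly normal* if any two disjoint sets $A_1,A_2$, each of which is a singleton or a member of $\mathrm{Cl}_X$, are contained in disjoint members of $\mathrm{Op}_X$. A map $f:X\to Y$ of gtses is *strictly continuous* if $f^{-1}(\mathcal V)=\{f^{-1}(V):V\in\mathcal V\}\in\mathrm{Cov}_X$ for all $\mathcal V\in\mathrm{Cov}_Y$. For $S\subseteq Y$ let $\mathrm{Cov}_Y\cap_2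 S=\{\{V\cap S:V\in\mathcal V\}:\mathcal V\in\mathrm{Cov}_Y\}$. The subspace $S$ of $Y$ carries the smallest generalized topology in $S$ that contains $\mathrm{Cov}_Y\cap_2 S$, and it is a *strict subspace* if this equals $\mathrm{Cov}_Y\cap_2 S$. A *strict embedding* is a strictly continuous injection $f$ such that $\{f(U):U\in\mathcal U\}\in\mathrm{Cov}_Y\cap_2 f(X)$ for all $\mathcal U\in\mathrm{Cov}_X$. A *strict compactification* of $X$ is a pair $(\alpha X,\alpha)$ where $\alpha X$ is a topologically compact gts and $\alpha:X\to\alpha X$ is a strict embedding with image dense in $(\alpha X)_{top}$. Strict compactifications $(\alpha X,\alpha)$ and $(\gamma X,\gamma)$ are *strictly equivalent* if there is a bijection $h:\alpha X\to\gamma X$, strictly continuous in both directions, with $h\circ\alpha=\gamma$. For weakly normal $X$, let $\mathcal W=\mathcal W(X,\mathrm{Cl}_X)$ be the set of all maximal proper filters in $\mathrm{Cl}_X$, with the topology that has the sets $\{p\in\mathcal W:A\in p\}$, $A\in\mathrm{Cl}_X$, as a closed base, and let $w(x)=\{A\in\mathrm{Cl}_X:x\in A\}$ for $x\in X$. Let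 $\mathrm{Op}^w_{\mathcal W}=\{\mathcal W\setminus\mathrm{cl}_{\mathcal W}(w(X\setminus U)):U\in\mathrm{Op}_X\}$, and let $\mathrm{Cov}^w_{\mathcal W}$ be the collection of all $\mathcal V\subseteq\mathrm{Op}^w_{\mathcal W}$ such that every $V\in\mathcal V$ is open in $\mathcal W$ with $w^{-1}(V)\in\mathrm{Op}_X$, and $w^{-1}(\mathcal V)\in\mathrm{Cov}_X$. If $\mathcal W$ is compact and $\mathrm{Cov}^w_{\mathcal W}$ is a generalized topology in $\mathcal W$, then $wX=(\mathcal W,\mathrm{Op}^w_{\mathcal W},\mathrm{Cov}^w_{\mathcal W})$, with the map $w$, is the *Wallman strict compactification* of $X$; otherwise $X$ has none. For a topologically locally compact, weakly normal gts $X$ and $A,B\in\mathrm{Cl}_X$, write $A\sim B$ if every member of $\mathrm{Cl}_X$ contained in $A\bigtriangleup B$ is topologically compact. This is an equivalence relation; let $[A]^X$ be the class of $A$, and let $L(\mathrm{Cl}_X)$ be the set of all classes, a lattice with $[A]^X\wedge[B]^X=[A\cap B]^X$ and $[A]^X\vee[B]^X=[A\cup B]^X$. **Theorem 6.6.** Let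 $X$ be a weakly normal, topologically non-compact, topologically locally compact small gts, let $K$ be a weakly Hausdorff, topologically compact small gts, and let $\psi:\mathrm{Cl}_K\to L(\mathrm{Cl}_X)$ be a lattice isomorphism. Let $X\cup_\psi K$ be the disjoint union of $X$ and $K$, and let $\mathrm{Op}^w$ be the family of the complements in $X\cup_\psi K$ of the sets $A\cup\psi^{-1}([A]^X)$ with $A\in\mathrm{Cl}_X$. Then $\alpha^w_\psi X=(X\cup_\psi K,\mathrm{Op}^w,\mathrm{EssFin}(\mathrm{Op}^w))$, with the inclusion of $X$, is a strict compactification of $X$. Moreover, $X$ has its Wallman strict compactification, it is strictly equivalent to $\alpha^w_\psi X$, and $K$, with its given generalized topology, is a strict subspace of $\alpha^w_\psi X$. -/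

import Mathlib

open Set

/-- A generalized topological space in the sense of Delfs and Knebusch on the set `X`:
a triple `(X, Op, Cov)` where `Op` is the family of open sets and `Cov` is the collection of
admissible open families. -/
structure GTS (X : Type*) where
  /-- the open sets -/
  Op : Set (Set X)
  /-- the admissible open families -/
  Cov : Set (Set (Set X))
  cov_subset : ∀ 𝒰 ∈ Cov, 𝒰 ⊆ Op
  empty_mem : ∅ ∈ Op
  univ_mem : univ ∈ Op
  union_mem : ∀ U ∈ Op, ∀ V ∈ Op, U ∪ V ∈ Op
  inter_mem : ∀ U ∈ Op, ∀ V ∈ Op, U ∩ V ∈ Op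
  /-- finiteness -/
  finite_mem : ∀ 𝒰, 𝒰 ⊆ Op → 𝒰.Finite → 𝒰 ∈ Cov
  /-- co-saturation: the union of an admissible family is open -/
  sUnion_mem : ∀ 𝒰 ∈ Cov, ⋃₀ 𝒰 ∈ Op
  /-- stability -/
  stable : ∀ 𝒰 ∈ Cov, ∀ V ∈ Op, V ⊆ ⋃₀ 𝒰 → (fun U => V ∩ U) '' 𝒰 ∈ Cov
  /-- transitivity -/
  transitive : ∀ 𝒰 ∈ Cov, ∀ 𝒱 : Set X → Set (Set X),
    (∀ U ∈ 𝒰, 𝒱 U ∈ Cov ∧ ⋃₀ 𝒱 U = U) → (⋃ U ∈ 𝒰, 𝒱 U) ∈ Cov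
  /-- saturation: an open family that coarsens an admissible family is admissible -/
  saturated : ∀ 𝒰 ∈ Cov, ∀ 𝒱, 𝒱 ⊆ Op → ⋃₀ 𝒱 = ⋃₀ 𝒰 → (∀ U ∈ 𝒰, ∃ V ∈ 𝒱, U ⊆ V) → 𝒱 ∈ Cov
  /-- regularity -/
  regular : ∀ 𝒰 ∈ Cov, ∀ W, W ⊆ ⋃₀ 𝒰 → (∀ U ∈ 𝒰, W ∩ U ∈ Op) → W ∈ Op

/-- The essentially finite subfamilies of `O`: those which have a finite subfamily with the same
union. -/
def EssFin {X : Type*} (O : Set (Set X)) : Set (Set (Set X)) :=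
  {𝒰 | 𝒰 ⊆ O ∧ ∃ 𝒱 ⊆ 𝒰, 𝒱.Finite ∧ ⋃₀ 𝒱 = ⋃₀ 𝒰}

namespace GTS

variable {X Y Z : Type*}

/-- The closed sets of a gts. -/
def Cl (G : GTS X) : Set (Set X) := {A | Aᶜ ∈ G.Op}

theorem union_mem_Cl (G : GTS X) {A B : Set X} (hA : A ∈ G.Cl) (hB : B ∈ G.Cl) :
    A ∪ B ∈ G.Cl := by
  have h := G.inter_mem _ hA _ hB
  rwa [← compl_union] at h

theorem inter_mem_Cl (G : GTS X) {A B : Set X} (hA : A ∈ G.Cl) (hB : B ∈ G.Cl) :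
    A ∩ B ∈ G.Cl := by
  have h := G.union_mem _ hA _ hB
  rwa [← compl_inter] at h

theorem empty_mem_Cl (G : GTS X) : ∅ ∈ G.Cl := by
  simpa [Cl] using G.univ_mem

theorem univ_mem_Cl (G : GTS X) : univ ∈ G.Cl := by
  simpa [Cl] using G.empty_mem

/-- The topology of the topologization `X_top` of a gts. -/
abbrev topology (G : GTS X) : TopologicalSpace X := TopologicalSpace.generateFrom G.Op

/-- A gts is small if its admissible families are exactly the essentially finite open families. -/
def IsSmall (G : GTS X) : Prop := G.Cov = EssFin G.Op

/-- Weak normality: disjoint sets each of which is a singleton or closed in the gts have disjoint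
open neighbourhoods in the gts. -/
def WeaklyNormal (G : GTS X) : Prop :=
  ∀ A B : Set X, ((∃ x, A = {x}) ∨ A ∈ G.Cl) → ((∃ x, B = {x}) ∨ B ∈ G.Cl) → Disjoint A B →
    ∃ U ∈ G.Op, ∃ V ∈ G.Op, A ⊆ U ∧ B ⊆ V ∧ Disjoint U V

/-- A gts is weakly Hausdorff if its topologization is Hausdorff. -/
def WeaklyHausdorff (G : GTS X) : Prop := @T2Space X G.topology

/-- A gts is topologically compact if its topologization is compact. -/
def TopCompact (G : GTS X) : Prop := @CompactSpace X G.topology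

/-- A gts is topologically locally compact if its topologization is locally compact. -/
def TopLocallyCompact (G : GTS X) : Prop := @LocallyCompactSpace X G.topology

/-- The small gts given by a family of sets that contains `∅` and the whole set and is stable under
binary unions and intersections. -/
def ofRing (O : Set (Set X)) (h0 : ∅ ∈ O) (h1 : univ ∈ O) (hU : ∀ U ∈ O, ∀ V ∈ O, U ∪ V ∈ O)
    (hI : ∀ U ∈ O, ∀ V ∈ O, U ∩ V ∈ O) : GTS X :=
  have fin : ∀ 𝒰 : Set (Set X), 𝒰.Finite → 𝒰 ⊆ O → ⋃₀ 𝒰 ∈ O := by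
    intro 𝒰 hf
    induction 𝒰, hf using Set.Finite.induction_on with
    | empty => intro _; simpa using h0
    | insert _ _ ih =>
      intro h
      rw [sUnion_insert]
      exact hU _ (h (mem_insert _ _)) _ (ih fun x hx => h (mem_insert_of_mem _ hx))
  { Op := O
    Cov := EssFin O
    cov_subset := fun _ h => h.1
    empty_mem := h0
    univ_mem := h1
    union_mem := hU
    inter_mem := hI
    finite_mem := fun 𝒰 h hf => ⟨h, 𝒰, Subset.rfl, hf, rfl⟩
    sUnion_mem := by
      rintro 𝒰 ⟨h, 𝒱, hs, hf, he⟩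
      rw [← he]
      exact fin 𝒱 hf (hs.trans h)
    stable := by
      rintro 𝒰 ⟨h, 𝒱, hs, hf, he⟩ V hV -
      refine ⟨?_, (fun U => V ∩ U) '' 𝒱, image_mono hs, hf.image _, ?_⟩
      · rintro _ ⟨U, hu, rfl⟩
        exact hI _ hV _ (h hu)
      · rw [sUnion_image, sUnion_image, ← inter_iUnion₂, ← inter_iUnion₂, ← sUnion_eq_biUnion,
          ← sUnion_eq_biUnion, he]
    transitive := by
      rintro 𝒰 ⟨h, 𝒱, hs, hf, he⟩ F hF
      choose! E hE hEf hEe using fun U hu => (hF U hu).1.2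
      refine ⟨?_, ⋃ U ∈ 𝒱, E U, ?_, hf.biUnion fun U hu => hEf U (hs hu), ?_⟩
      · exact iUnion₂_subset fun U hu => (hF U hu).1.1
      · exact iUnion₂_subset fun U hu =>
          (hE U (hs hu)).trans (subset_biUnion_of_mem (u := F) (hs hu))
      · apply Subset.antisymm
        · apply sUnion_mono
          exact iUnion₂_subset fun U hu =>
            (hE U (hs hu)).trans (subset_biUnion_of_mem (u := F) (hs hu))
        · rintro x ⟨V, hV, hx⟩
          obtain ⟨U, hu, hVU⟩ := mem_iUnion₂.1 hV
          have hxU : x ∈ ⋃₀ 𝒰 := ⟨U, hu, (hF U hu).2 ▸ ⟨V, hVU, hx⟩⟩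
          rw [← he] at hxU
          obtain ⟨U', hu', hx'⟩ := hxU
          rw [← (hF U' (hs hu')).2, ← hEe U' (hs hu')] at hx'
          obtain ⟨W, hW, hxW⟩ := hx'
          exact ⟨W, mem_iUnion₂.2 ⟨U', hu', hW⟩, hxW⟩
    saturated := by
      rintro 𝒰 ⟨h, 𝒲, hs, hf, he⟩ 𝒱 hV hu hr
      choose! r hr1 hr2 using hr
      refine ⟨hV, r '' 𝒲, ?_, hf.image _, ?_⟩
      · rintro _ ⟨U, hU', rfl⟩
        exact hr1 U (hs hU')
      · apply Subset.antisymm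
        · apply sUnion_mono
          rintro _ ⟨U, hU', rfl⟩
          exact hr1 U (hs hU')
        · rw [hu, ← he]
          rintro x ⟨U, hU', hx⟩
          exact ⟨r U, mem_image_of_mem _ hU', hr2 U (hs hU') hx⟩
    regular := by
      rintro 𝒰 ⟨h, 𝒱, hs, hf, he⟩ W hW hu
      have e : ⋃₀ ((fun U => W ∩ U) '' 𝒱) = W := by
        rw [sUnion_image, ← inter_iUnion₂, ← sUnion_eq_biUnion, he]
        exact inter_eq_left.2 hW
      rw [← e]
      apply fin _ (hf.image _)
      rintro _ ⟨U, hU', rfl⟩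
      exact hu U (hs hU') }

/-- The smallest generalized topology `⟨𝒜⟩` that contains a collection `𝒜` of families of sets: the
intersection of all generalized topologies that contain `𝒜`. -/
def generate (𝒜 : Set (Set (Set X))) : GTS X where
  Op := {U | ∀ H : GTS X, 𝒜 ⊆ H.Cov → U ∈ H.Op}
  Cov := {𝒰 | ∀ H : GTS X, 𝒜 ⊆ H.Cov → 𝒰 ∈ H.Cov}
  cov_subset := fun _ h _ hU H hH => H.cov_subset _ (h H hH) hU
  empty_mem := fun H _ => H.empty_mem
  univ_mem := fun H _ => H.univ_mem
  union_mem := fun _ hU _ hV H hH => H.union_mem _ (hU H hH) _ (hV H hH)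
  inter_mem := fun _ hU _ hV H hH => H.inter_mem _ (hU H hH) _ (hV H hH)
  finite_mem := fun _ h hf H hH => H.finite_mem _ (fun _ hU => h hU H hH) hf
  sUnion_mem := fun _ h H hH => H.sUnion_mem _ (h H hH)
  stable := fun _ h _ hV hs H hH => H.stable _ (h H hH) _ (hV H hH) hs
  transitive := fun _ h _ hV H hH =>
    H.transitive _ (h H hH) _ fun U hU => ⟨(hV U hU).1 H hH, (hV U hU).2⟩
  saturated := fun _ h _ hV hs hr H hH =>
    H.saturated _ (h H hH) _ (fun _ hU => hV hU H hH) hs hr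
  regular := fun _ h _ hW hs H hH => H.regular _ (h H hH) _ hW fun U hU => hs U hU H hH

theorem subset_generate (𝒜 : Set (Set (Set X))) : 𝒜 ⊆ (generate 𝒜).Cov := fun _ h _ hH => hH h

theorem generate_subset {𝒜 : Set (Set (Set X))} {H : GTS X} (h : 𝒜 ⊆ H.Cov) :
    (generate 𝒜).Cov ⊆ H.Cov := fun _ h' => h' H h

/-- The preimage `f⁻¹(𝒱)` of a family of sets. -/
def preFamily (f : X → Y) (𝒱 : Set (Set Y)) : Set (Set X) := (fun V => f ⁻¹' V) '' 𝒱

/-- The collection `Cov_Y ∩₂ f(X)` of all traces on `f(X)` of admissible families of `Y`, where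
`f(X)` is identified with `X` along the injection `f`. (For a subset of `Y`, take for `f` its
inclusion.) -/
def trace (H : GTS Y) (f : X → Y) : Set (Set (Set X)) := preFamily f '' H.Cov

/-- Strict continuity: preimages of admissible families are admissible. -/
def StrictlyContinuous (G : GTS X) (H : GTS Y) (f : X → Y) : Prop :=
  ∀ 𝒱 ∈ H.Cov, preFamily f 𝒱 ∈ G.Cov

/-- An embedding of gtses (the subset `f(X)` is identified with `X` along the injection `f`). -/
structure IsEmbedding (G : GTS X) (H : GTS Y) (f : X → Y) : Prop where
  strictlyContinuous : StrictlyContinuous G H f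
  injective : Function.Injective f
  cov_subset_generate : G.Cov ⊆ (generate (H.trace f)).Cov

/-- A strict embedding of gtses. -/
structure IsStrictEmbedding (G : GTS X) (H : GTS Y) (f : X → Y) : Prop
    extends IsEmbedding G H f where
  cov_subset_trace : G.Cov ⊆ H.trace f

/-- `G`, identified with a subset of `H` along the injection `f`, is a strict subspace of `H`: its
generalized topology is the subspace one, `⟨Cov_H ∩₂ f(X)⟩`, and
`⟨Cov_H ∩₂ f(X)⟩ = Cov_H ∩₂ f(X)`. -/
structure IsStrictSubspace (G : GTS X) (H : GTS Y) (f : X → Y) : Prop where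
  injective : Function.Injective f
  cov_eq : G.Cov = (generate (H.trace f)).Cov
  generate_eq : (generate (H.trace f)).Cov = H.trace f

/-- `(H, α)` is a strict compactification of `G`. -/
structure IsStrictCompactification (G : GTS X) (H : GTS Y) (α : X → Y) : Prop where
  topCompact : H.TopCompact
  isStrictEmbedding : IsStrictEmbedding G H α
  dense : @Dense Y H.topology (range α)

/-- `(H, α)` and `(H', γ)` are strictly equivalent: there is a strict homeomorphism `h` (a bijection
strictly continuous in both directions) with `h ∘ α = γ`. -/
def StrictlyEquivalent (H : GTS Y) (α : X → Y) (H' : GTS Z) (γ : X → Z) : Prop :=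
  ∃ h : Y ≃ Z, StrictlyContinuous H H' h ∧ StrictlyContinuous H' H h.symm ∧ h ∘ α = γ

/-! Extensions of a gts over a compactification `α : X → Y` of its topologization. -/

/-- The open sets of the strongest generalized topology in `Y` associated with `G`. -/
def strongOp (G : GTS X) [TopologicalSpace Y] (α : X → Y) : Set (Set Y) :=
  {V | IsOpen V ∧ α ⁻¹' V ∈ G.Op}

/-- The strongest generalized topology in `Y` associated with `G`. -/
def strongCov (G : GTS X) [TopologicalSpace Y] (α : X → Y) : Set (Set (Set Y)) :=
  {𝒱 | 𝒱 ⊆ G.strongOp α ∧ preFamily α 𝒱 ∈ G.Cov}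

/-- The operator `Ex(U) = Y \ cl (X \ U)`. -/
def Ex [TopologicalSpace Y] (α : X → Y) (U : Set X) : Set Y := (closure (α '' Uᶜ))ᶜ

/-- The wallmanian part of `strongOp`. -/
def wallmanOp (G : GTS X) [TopologicalSpace Y] (α : X → Y) : Set (Set Y) := Ex α '' G.Op

/-- The wallmanian part of `strongCov`. -/
def wallmanCov (G : GTS X) [TopologicalSpace Y] (α : X → Y) : Set (Set (Set Y)) :=
  {𝒱 | 𝒱 ∈ G.strongCov α ∧ 𝒱 ⊆ G.wallmanOp α}

end GTS

/-! ### The Wallman space -/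

/-- `p` is a (proper) filter in the ring of sets `C`. -/
structure IsFilterIn {X : Type*} (C p : Set (Set X)) : Prop where
  subset : p ⊆ C
  nonempty : p.Nonempty
  empty_notMem : ∅ ∉ p
  inter_mem : ∀ A ∈ p, ∀ B ∈ p, A ∩ B ∈ p
  mem_of_superset : ∀ A ∈ p, ∀ B ∈ C, A ⊆ B → B ∈ p

/-- `p` is an ultrafilter in the ring of sets `C`: a maximal filter. -/
structure IsUltrafilterIn {X : Type*} (C p : Set (Set X)) : Prop extends IsFilterIn C p where
  maximal : ∀ q, IsFilterIn C q → p ⊆ q → q = p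

/-- The set of all ultrafilters in `C`. -/
def WallmanSpace {X : Type*} (C : Set (Set X)) : Type _ := {p : Set (Set X) // IsUltrafilterIn C p}

namespace WallmanSpace

/-- The set `[A]_C` of all ultrafilters in `C` that contain `A`. -/
def basic {X : Type*} (C : Set (Set X)) (A : Set X) : Set (WallmanSpace C) := {p | A ∈ p.1}

/-- The topology of the Wallman space: the sets `[A]_C` with `A ∈ C` form a closed base. -/
instance {X : Type*} (C : Set (Set X)) : TopologicalSpace (WallmanSpace C) :=
  TopologicalSpace.generateFrom {U | ∃ A ∈ C, U = (basic C A)ᶜ}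

end WallmanSpace

namespace GTS

variable {X K : Type*}

/-- The canonical map `x ↦ {A ∈ Cl_X : x ∈ A}` into the Wallman space of a weakly normal gts. -/
def wallmanMap (G : GTS X) (hG : G.WeaklyNormal) (x : X) : WallmanSpace G.Cl :=
  ⟨{A | A ∈ G.Cl ∧ x ∈ A},
    { subset := fun _ h => h.1
      nonempty := ⟨univ, G.univ_mem_Cl, mem_univ x⟩
      empty_notMem := fun h => h.2
      inter_mem := fun _ hA _ hB => ⟨G.inter_mem_Cl hA.1 hB.1, hA.2, hB.2⟩
      mem_of_superset := fun _ hA _ hB h => ⟨hB, h hA.2⟩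
      maximal := by
        intro q hq hpq
        refine Subset.antisymm (fun B hB => ⟨hq.subset hB, ?_⟩) hpq
        by_contra hx
        obtain ⟨U, hU, V, hV, hxU, hBV, hd⟩ :=
          hG {x} B (Or.inl ⟨x, rfl⟩) (Or.inr (hq.subset hB)) (disjoint_singleton_left.2 hx)
        have hVc : Vᶜ ∈ q := hpq ⟨by simpa [Cl] using hV,
          disjoint_left.1 hd (hxU rfl)⟩
        have h0 := hq.inter_mem _ hVc _ hB
        have he : Vᶜ ∩ B = ∅ := by
          ext y
          simp only [mem_inter_iff, mem_compl_iff, mem_empty_iff_false, iff_false, not_and]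
          exact fun h1 h2 => h1 (hBV h2)
        exact hq.empty_notMem (he ▸ h0) }⟩

/-- `W` is the Wallman strict compactification of the weakly normal gts `G`: the Wallman space of
`G` is compact, and the wallmanian part of the strongest generalized topology on it is a generalized
topology, namely that of `W`. -/
structure IsWallmanStrictCompactification (G : GTS X) (hG : G.WeaklyNormal)
    (W : GTS (WallmanSpace G.Cl)) : Prop where
  compact : CompactSpace (WallmanSpace G.Cl)
  op_eq : W.Op = G.wallmanOp (G.wallmanMap hG)
  cov_eq : W.Cov = G.wallmanCov (G.wallmanMap hG)

/-! ### The lattice `L(Cl_X)` and the space `X ∪_ψ K` -/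

/-- The lattice of the closed sets of a gts, under union and intersection. -/
def clLattice (G : GTS X) : Sublattice (Set X) where
  carrier := G.Cl
  supClosed' := fun _ hA _ hB => G.union_mem_Cl hA hB
  infClosed' := fun _ hA _ hB => G.inter_mem_Cl hA hB

/-- The relation `A ∼ B` on `Cl_X`: the symmetric difference of `A` and `B` contains no
topologically non-compact member of `Cl_X`. -/
def remRel (G : GTS X) (A B : G.clLattice) : Prop :=
  ∀ D ∈ G.Cl, D ⊆ symmDiff (A : Set X) (B : Set X) → @IsCompact X G.topology D

theorem remRel_refl (G : GTS X) (A : G.clLattice) : G.remRel A A := by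
  intro D _ h
  rw [symmDiff_self] at h
  rw [subset_empty_iff.1 h]
  exact @isCompact_empty X G.topology

/-- In a topologically locally compact gts, every topologically compact set is
contained in an open set of the gts which is contained in a topologically compact set. -/
theorem exists_op_between (G : GTS X) (hl : G.TopLocallyCompact) (C : Set X)
    (hC : @IsCompact X G.topology C) :
    ∃ U ∈ G.Op, C ⊆ U ∧ ∃ E, @IsCompact X G.topology E ∧ U ⊆ E := by
  let _ := G.topology
  have : LocallyCompactSpace X := hl
  have hop : ∀ U ∈ G.Op, IsOpen U := fun U hU => TopologicalSpace.isOpen_generateFrom_of_mem hU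
  have hb : TopologicalSpace.IsTopologicalBasis G.Op := by
    refine ⟨fun U hU V hV x hx => ⟨U ∩ V, G.inter_mem _ hU _ hV, hx, Subset.rfl⟩, ?_, rfl⟩
    exact eq_univ_of_univ_subset (subset_sUnion_of_mem G.univ_mem)
  have hloc : ∀ x : X, ∃ U ∈ G.Op, x ∈ U ∧ ∃ E, IsCompact E ∧ U ⊆ E := by
    intro x
    obtain ⟨E, hE, hxE⟩ := exists_compact_mem_nhds x
    obtain ⟨U, hU, hxU, hUE⟩ := hb.mem_nhds_iff.1 hxE
    exact ⟨U, hU, hxU, E, hE, hUE⟩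
  refine hC.induction_on (p := fun C => ∃ U ∈ G.Op, C ⊆ U ∧ ∃ E, IsCompact E ∧ U ⊆ E) ?_ ?_ ?_ ?_
  · exact ⟨∅, G.empty_mem, Subset.rfl, ∅, isCompact_empty, Subset.rfl⟩
  · rintro s t hst ⟨U, hU, h, hE⟩
    exact ⟨U, hU, hst.trans h, hE⟩
  · rintro s t ⟨U, hU, h, E, hE, hUE⟩ ⟨V, hV, h', F, hF, hVF⟩
    exact ⟨U ∪ V, G.union_mem _ hU _ hV, union_subset_union h h', E ∪ F, hE.union hF,
      union_subset_union hUE hVF⟩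
  · intro x _
    obtain ⟨U, hU, hxU, hE⟩ := hloc x
    exact ⟨U, mem_nhdsWithin_of_mem_nhds ((hop U hU).mem_nhds hxU), U, hU, Subset.rfl, hE⟩

/-- On a topologically locally compact gts, `∼` is an equivalence relation. -/
theorem remRel_equivalence (G : GTS X) (hl : G.TopLocallyCompact) :
    Equivalence G.remRel := by
  refine ⟨G.remRel_refl, ?_, ?_⟩
  · intro A B h D hD hs
    rw [symmDiff_comm] at hs
    exact h D hD hs
  · let _ := G.topology
    have hcl : ∀ D ∈ G.Cl, IsClosed D := fun D hD =>
      ⟨TopologicalSpace.isOpen_generateFrom_of_mem hD⟩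
    have key : ∀ A B C : G.clLattice, G.remRel A B → G.remRel B C → ∀ D ∈ G.Cl,
        D ⊆ (A : Set X) \ (C : Set X) → IsCompact D := by
      intro A B C hAB hBC D hD hs
      have h1 : IsCompact (D ∩ B) := hBC _ (G.inter_mem_Cl hD B.2) fun x hx =>
        Or.inl ⟨hx.2, (hs hx.1).2⟩
      obtain ⟨U, hU, hDU, E, hE, hUE⟩ := G.exists_op_between hl _ h1
      have hUc : Uᶜ ∈ G.Cl := by simpa [Cl] using hU
      have h2 : IsCompact (D ∩ Uᶜ) := hAB _ (G.inter_mem_Cl hD hUc) fun x hx =>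
        Or.inl ⟨(hs hx.1).1, fun hB => hx.2 (hDU ⟨hx.1, hB⟩)⟩
      refine (h2.union hE).of_isClosed_subset (hcl D hD) fun x hx => ?_
      by_cases hxU : x ∈ U
      · exact Or.inr (hUE hxU)
      · exact Or.inl ⟨hx, hxU⟩
    have symm : ∀ A B : G.clLattice, G.remRel A B → G.remRel B A := by
      intro A B h D hD hs
      rw [symmDiff_comm] at hs
      exact h D hD hs
    intro A B C hAB hBC D hD hs
    have hA : IsCompact (D ∩ A) := key A B C hAB hBC _ (G.inter_mem_Cl hD A.2) fun x hx =>
      ⟨hx.2, fun hC => (hs hx.1).elim (fun h => h.2 hC) fun h => h.2 hx.2⟩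
    have hC : IsCompact (D ∩ C) :=
      key C B A (symm _ _ hBC) (symm _ _ hAB) _ (G.inter_mem_Cl hD C.2) fun x hx =>
        ⟨hx.2, fun hA => (hs hx.1).elim (fun h => h.2 hx.2) fun h => h.2 hA⟩
    refine (hA.union hC).of_isClosed_subset (hcl D hD) fun x hx => ?_
    exact (hs hx).elim (fun h => Or.inl ⟨hx, h.1⟩) fun h => Or.inr ⟨hx, h.1⟩

/-- The quotient `L(Cl_X)` of `Cl_X` by `∼`. -/
def RemLattice (G : GTS X) : Type _ := Quot G.remRel

/-- The class `[A]^X` of a closed set `A`. -/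
def remClass (G : GTS X) (A : G.clLattice) : G.RemLattice := Quot.mk _ A

theorem remRel_sup (G : GTS X) (A B C : G.clLattice) (h : G.remRel A B) :
    G.remRel (A ⊔ C) (B ⊔ C) := by
  intro D hD hs
  refine h D hD fun x hx => ?_
  rcases hs hx with ⟨h1 | h1, h2⟩ | ⟨h1 | h1, h2⟩
  · exact Or.inl ⟨h1, fun h3 => h2 (Or.inl h3)⟩
  · exact absurd (Or.inr h1) h2
  · exact Or.inr ⟨h1, fun h3 => h2 (Or.inl h3)⟩
  · exact absurd (Or.inr h1) h2

theorem remRel_inf (G : GTS X) (A B C : G.clLattice) (h : G.remRel A B) :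
    G.remRel (A ⊓ C) (B ⊓ C) := by
  intro D hD hs
  refine h D hD fun x hx => ?_
  rcases hs hx with ⟨h1, h2⟩ | ⟨h1, h2⟩
  · exact Or.inl ⟨h1.1, fun h3 => h2 ⟨h3, h1.2⟩⟩
  · exact Or.inr ⟨h1.1, fun h3 => h2 ⟨h3, h1.2⟩⟩

/-- The join `[A] ∨ [B] = [A ∪ B]`. -/
instance (G : GTS X) : Max G.RemLattice where
  max := Quot.map₂ (fun A B => A ⊔ B)
    (fun A B C h => by simpa only [sup_comm A] using G.remRel_sup B C A h)
    (fun A B C h => G.remRel_sup A B C h)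

/-- The meet `[A] ∧ [B] = [A ∩ B]`. -/
instance (G : GTS X) : Min G.RemLattice where
  min := Quot.map₂ (fun A B => A ⊓ B)
    (fun A B C h => by simpa only [inf_comm A] using G.remRel_inf B C A h)
    (fun A B C h => G.remRel_inf A B C h)

theorem remClass_sup (G : GTS X) (A B : G.clLattice) :
    G.remClass (A ⊔ B) = G.remClass A ⊔ G.remClass B := rfl

theorem remClass_inf (G : GTS X) (A B : G.clLattice) :
    G.remClass (A ⊓ B) = G.remClass A ⊓ G.remClass B := rfl

/-- `L(Cl_X)` is a lattice with `[A] ∨ [B] = [A ∪ B]` and `[A] ∧ [B] = [A ∩ B]`. -/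
instance (G : GTS X) : Lattice G.RemLattice :=
  Lattice.mk'
    (by rintro ⟨A⟩ ⟨B⟩; exact congrArg (Quot.mk _) (sup_comm A B))
    (by rintro ⟨A⟩ ⟨B⟩ ⟨C⟩; exact congrArg (Quot.mk _) (sup_assoc A B C))
    (by rintro ⟨A⟩ ⟨B⟩; exact congrArg (Quot.mk _) (inf_comm A B))
    (by rintro ⟨A⟩ ⟨B⟩ ⟨C⟩; exact congrArg (Quot.mk _) (inf_assoc A B C))
    (by rintro ⟨A⟩ ⟨B⟩; exact congrArg (Quot.mk _) sup_inf_self)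
    (by rintro ⟨A⟩ ⟨B⟩; exact congrArg (Quot.mk _) inf_sup_self)

/-- The set `A ∪ ψ⁻¹([A]^X)` in the disjoint union `X ⊕ K`. (An isomorphism of lattices is the same
as an order isomorphism.) -/
def glueSet {G : GTS X} {H : GTS K} (ψ : H.clLattice ≃o G.RemLattice) (A : G.clLattice) :
    Set (X ⊕ K) :=
  Sum.inl '' (A : Set X) ∪ Sum.inr '' (ψ.symm (G.remClass A) : Set K)

/-- The family `Cl^w` of all sets `A ∪ ψ⁻¹([A]^X)` with `A ∈ Cl_X`. -/
def glueCl {G : GTS X} {H : GTS K} (ψ : H.clLattice ≃o G.RemLattice) : Set (Set (X ⊕ K)) :=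
  range (glueSet ψ)

/-- The family `Op^w` of the complements of the members of `Cl^w`. -/
def glueOp {G : GTS X} {H : GTS K} (ψ : H.clLattice ≃o G.RemLattice) : Set (Set (X ⊕ K)) :=
  {U | Uᶜ ∈ glueCl ψ}

theorem glueSet_sup {G : GTS X} {H : GTS K} (ψ : H.clLattice ≃o G.RemLattice)
    (A B : G.clLattice) : glueSet ψ (A ⊔ B) = glueSet ψ A ∪ glueSet ψ B := by
  have h : ψ.symm (G.remClass A ⊔ G.remClass B) = _ := ψ.symm.map_sup _ _
  simp only [glueSet, remClass_sup, h, Sublattice.coe_sup, sup_eq_union, image_union]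
  ac_rfl

theorem glueSet_inf {G : GTS X} {H : GTS K} (ψ : H.clLattice ≃o G.RemLattice)
    (A B : G.clLattice) : glueSet ψ (A ⊓ B) = glueSet ψ A ∩ glueSet ψ B := by
  have h : ψ.symm (G.remClass A ⊓ G.remClass B) = _ := ψ.symm.map_inf _ _
  ext (x | x)
  · simp [glueSet]
  · simp only [glueSet, remClass_inf, h]
    simp

theorem glueSet_empty {G : GTS X} {H : GTS K} (ψ : H.clLattice ≃o G.RemLattice) :
    glueSet ψ ⟨∅, G.empty_mem_Cl⟩ = ∅ := by
  have h : ψ.symm (G.remClass ⟨∅, G.empty_mem_Cl⟩) ≤ ⟨∅, H.empty_mem_Cl⟩ := by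
    rw [ψ.symm_apply_le]
    generalize ψ ⟨∅, H.empty_mem_Cl⟩ = c
    obtain ⟨C⟩ := c
    refine sup_eq_right.1 (?_ : G.remClass _ ⊔ G.remClass C = G.remClass C)
    rw [← remClass_sup]
    exact congrArg _ (Subtype.ext (empty_union (C : Set X)))
  have h' : (ψ.symm (G.remClass ⟨∅, G.empty_mem_Cl⟩) : Set K) = ∅ := subset_empty_iff.1 h
  simp [glueSet, h']

theorem glueSet_univ {G : GTS X} {H : GTS K} (ψ : H.clLattice ≃o G.RemLattice) :
    glueSet ψ ⟨univ, G.univ_mem_Cl⟩ = univ := by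
  have h : ⟨univ, H.univ_mem_Cl⟩ ≤ ψ.symm (G.remClass ⟨univ, G.univ_mem_Cl⟩) := by
    rw [ψ.le_symm_apply]
    generalize ψ ⟨univ, H.univ_mem_Cl⟩ = c
    obtain ⟨C⟩ := c
    refine sup_eq_right.1 (?_ : G.remClass C ⊔ G.remClass _ = G.remClass _)
    rw [← remClass_sup]
    exact congrArg _ (Subtype.ext (union_univ (C : Set X)))
  have h' : (ψ.symm (G.remClass ⟨univ, G.univ_mem_Cl⟩) : Set K) = univ := univ_subset_iff.1 h
  simp [glueSet, h', range_inl_union_range_inr]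

/-- The gts `X ∪_ψ K` whose open sets are the members of `Op^w` and whose admissible families are
the essentially finite subfamilies of `Op^w`. -/
def glue {G : GTS X} {H : GTS K} (ψ : H.clLattice ≃o G.RemLattice) : GTS (X ⊕ K) :=
  ofRing (glueOp ψ)
    ⟨_, (glueSet_univ ψ).trans compl_empty.symm⟩
    ⟨_, (glueSet_empty ψ).trans compl_univ.symm⟩
    (by
      rintro U ⟨A, hA⟩ V ⟨B, hB⟩
      exact ⟨A ⊓ B, by rw [glueSet_inf, hA, hB, compl_union]⟩)
    (by
      rintro U ⟨A, hA⟩ V ⟨B, hB⟩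
      exact ⟨A ⊔ B, by rw [glueSet_sup, hA, hB, compl_inter]⟩)

end GTS

/-!
Write `e(A) ⊆ K` for the closed set `ψ⁻¹([A])`, so that the closed sets of `X ∪_ψ K` are the sets
`A ∪ e(A)`. The map `e` is a surjective lattice homomorphism, `e(A) ⊆ e(B)` says that every closed
subset of `A \ B` is compact, and in particular `e(A) = ∅` exactly when `A` is compact.

*Compactness* (`topCompact_glue`). Let a family of sets `A ∪ e(A)` have the finite intersection
property. If some finite intersection of the `A`s is compact, the compactness of that set gives a
common point in `X`; otherwise all finite intersections of the sets `e(A)` are nonempty, and the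
compactness of `K` gives a common point in `K`.

*Embeddings.* Between small gtses everything is decided by the open sets: if the traces of the open
sets of `Y` on `X` are exactly the open sets of `X`, then the admissible families of `X` are exactly
the traces of those of `Y` (`IsSmall.cov_eq_trace`). This applies to `X` and to `K` in `X ∪_ψ K`.

*The Wallman space* (`glueEquiv`). A point `y` of `X ∪_ψ K` gives the filter of all `A` with
`y ∈ A ∪ e(A)`. For `y` in `K` it is maximal: if `y ∉ e(B)`, then compactness and Hausdorffness
of `K` give `A` with `y ∈ e(A)` and `e(A) ∩ e(B) = ∅`, so that `A ∩ B` is compact; by local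
compactness a relatively compact open neighbourhood of `A ∩ B` can be removed from `A` without
changing `e(A)`, and then `A` is disjoint from `B`. Every ultrafilter arises in this way because
`X ∪_ψ K` is compact. Hence the Wallman space is `X ∪_ψ K` with `A ∪ e(A)` in place of the set of
all ultrafilters that contain `A`; and `A ∪ e(A)` is the closure of `A`, so the wallmanian open
sets are those of `X ∪_ψ K`. Finally, `Ex` preserves finite unions, so a family of wallmanian open
sets is essentially finite as soon as its trace on `X` is.
-/

/-! ### Small generalized topological spaces -/

namespace GTS

variable {X Y K : Type*}

theorem sUnion_mem_of_finite (G : GTS X) {𝒰 : Set (Set X)} (h : 𝒰 ⊆ G.Op) (hf : 𝒰.Finite) :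
    ⋃₀ 𝒰 ∈ G.Op :=
  G.sUnion_mem _ (G.finite_mem _ h hf)

theorem isOpen_of_mem_Op (G : GTS X) {U : Set X} (hU : U ∈ G.Op) : @IsOpen X G.topology U :=
  TopologicalSpace.isOpen_generateFrom_of_mem hU

theorem isClosed_of_mem_Cl (G : GTS X) {A : Set X} (hA : A ∈ G.Cl) : @IsClosed X G.topology A :=
  @IsClosed.mk X G.topology A (G.isOpen_of_mem_Op hA)

theorem compl_mem_Cl (G : GTS X) {U : Set X} (hU : U ∈ G.Op) : Uᶜ ∈ G.Cl := by
  simpa [Cl] using hU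

theorem isTopologicalBasis_Op (G : GTS X) :
    @TopologicalSpace.IsTopologicalBasis X G.topology G.Op := by
  let _ := G.topology
  refine ⟨fun U hU V hV x hx => ⟨U ∩ V, G.inter_mem _ hU _ hV, hx, Subset.rfl⟩, ?_, rfl⟩
  exact eq_univ_of_univ_subset (subset_sUnion_of_mem G.univ_mem)

theorem preFamily_sUnion (f : X → Y) (𝒱 : Set (Set Y)) :
    ⋃₀ preFamily f 𝒱 = f ⁻¹' ⋃₀ 𝒱 := by
  simp [preFamily, sUnion_image, preimage_sUnion]

theorem preFamily_mem_essFin {f : X → Y} {O : Set (Set X)} {O' : Set (Set Y)}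
    (h : ∀ V ∈ O', f ⁻¹' V ∈ O) {𝒱 : Set (Set Y)} (h𝒱 : 𝒱 ∈ EssFin O') :
    preFamily f 𝒱 ∈ EssFin O := by
  obtain ⟨h1, 𝒲, hs, hf, he⟩ := h𝒱
  refine ⟨?_, preFamily f 𝒲, image_mono hs, hf.image _, ?_⟩
  · rintro _ ⟨V, hV, rfl⟩
    exact h V (h1 hV)
  · rw [preFamily_sUnion, preFamily_sUnion, he]

theorem IsSmall.strictlyContinuous {G : GTS X} {H : GTS Y} (hG : G.IsSmall) (hH : H.IsSmall)
    {f : X → Y} (h : ∀ V ∈ H.Op, f ⁻¹' V ∈ G.Op) : StrictlyContinuous G H f := by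
  intro 𝒱 h𝒱
  rw [IsSmall] at hG hH
  rw [hG]
  rw [hH] at h𝒱
  exact preFamily_mem_essFin h h𝒱

/-- Between small gtses, equality of the traces of the open sets with the open sets gives the same
equality for the admissible families. -/
theorem IsSmall.cov_eq_trace {G : GTS X} {H : GTS Y} (hG : G.IsSmall) (hH : H.IsSmall) {f : X → Y}
    (h : ∀ V ∈ H.Op, f ⁻¹' V ∈ G.Op) (h' : ∀ U ∈ G.Op, ∃ V ∈ H.Op, f ⁻¹' V = U) :
    G.Cov = H.trace f := by
  apply Subset.antisymm
  · intro 𝒰 h𝒰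
    rw [hG] at h𝒰
    obtain ⟨h1, 𝒲, hs, hf, he⟩ := h𝒰
    choose! E hE hE' using h'
    -- Arbitrary lifts of the members of `𝒰` need not be covered by finitely many of them, so the
    -- lifts are cut down to the union `T` of those of the finite subfamily.
    set T := ⋃₀ (E '' 𝒲) with hT
    have hTmem : T ∈ H.Op :=
      H.sUnion_mem_of_finite (by rintro _ ⟨U, hU, rfl⟩; exact hE U (h1 (hs hU))) (hf.image _)
    have hTpre : f ⁻¹' T = ⋃₀ 𝒰 := by
      rw [← he, hT, sUnion_image, preimage_iUnion₂, sUnion_eq_biUnion]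
      exact iUnion₂_congr fun U hU => hE' U (h1 (hs hU))
    refine ⟨(fun U => E U ∩ T) '' 𝒰, ?_, ?_⟩
    · rw [hH]
      refine ⟨?_, (fun U => E U ∩ T) '' 𝒲, image_mono hs, hf.image _, ?_⟩
      · rintro _ ⟨U, hU, rfl⟩
        exact H.inter_mem _ (hE U (h1 hU)) _ hTmem
      · refine Subset.antisymm (sUnion_mono (image_mono hs)) ?_
        rintro y ⟨_, ⟨U, hU, rfl⟩, -, ⟨_, ⟨V, hV, rfl⟩, hy⟩⟩
        exact ⟨_, ⟨V, hV, rfl⟩, hy, _, ⟨V, hV, rfl⟩, hy⟩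
    · rw [preFamily, image_image]
      refine (image_congr fun U hU => ?_).trans (image_id 𝒰)
      rw [preimage_inter, hE' U (h1 hU), hTpre]
      exact inter_eq_left.2 (subset_sUnion_of_mem hU)
  · rintro _ ⟨𝒱, h𝒱, rfl⟩
    exact hG.strictlyContinuous hH h 𝒱 h𝒱

theorem IsSmall.isStrictEmbedding {G : GTS X} {H : GTS Y} (hG : G.IsSmall) (hH : H.IsSmall)
    {f : X → Y} (hf : Function.Injective f)
    (h : ∀ V ∈ H.Op, f ⁻¹' V ∈ G.Op) (h' : ∀ U ∈ G.Op, ∃ V ∈ H.Op, f ⁻¹' V = U) :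
    IsStrictEmbedding G H f where
  strictlyContinuous := hG.strictlyContinuous hH h
  injective := hf
  cov_subset_generate := (hG.cov_eq_trace hH h h').subset.trans (subset_generate _)
  cov_subset_trace := (hG.cov_eq_trace hH h h').subset

theorem IsSmall.isStrictSubspace {G : GTS X} {H : GTS Y} (hG : G.IsSmall) (hH : H.IsSmall)
    {f : X → Y} (hf : Function.Injective f)
    (h : ∀ V ∈ H.Op, f ⁻¹' V ∈ G.Op) (h' : ∀ U ∈ G.Op, ∃ V ∈ H.Op, f ⁻¹' V = U) :
    IsStrictSubspace G H f := by
  have e := hG.cov_eq_trace hH h h'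
  have e' : (generate (H.trace f)).Cov = H.trace f :=
    Subset.antisymm ((generate_subset e.symm.subset).trans e.subset) (subset_generate _)
  exact ⟨hf, e.trans e'.symm, e'⟩

/-- A family of open sets is admissible if its trace is, provided that inclusions between open sets
are determined by the traces. -/
theorem IsSmall.mem_cov_of_preFamily {G : GTS X} {H : GTS Y} (hG : G.IsSmall) (hH : H.IsSmall)
    {f : X → Y} (hmono : ∀ V ∈ H.Op, ∀ V' ∈ H.Op, f ⁻¹' V ⊆ f ⁻¹' V' → V ⊆ V')
    {𝒱 : Set (Set Y)} (h𝒱 : 𝒱 ⊆ H.Op) (hc : preFamily f 𝒱 ∈ G.Cov) : 𝒱 ∈ H.Cov := by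
  rw [hG] at hc
  obtain ⟨-, 𝒲, hs, hf, he⟩ := hc
  obtain ⟨𝒱', hs', hf', he⟩ := exists_subset_image_finite_and
    (p := fun t => ⋃₀ t = ⋃₀ preFamily f 𝒱) |>.1 ⟨𝒲, hs, hf, he⟩
  rw [hH]
  refine ⟨h𝒱, 𝒱', hs', hf', Subset.antisymm (sUnion_mono hs') (sUnion_subset fun V hV => ?_)⟩
  refine hmono V (h𝒱 hV) _ (H.sUnion_mem_of_finite (hs'.trans h𝒱) hf') ?_
  rw [← preFamily_sUnion, preFamily, he, preFamily_sUnion]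
  exact preimage_mono (subset_sUnion_of_mem hV)

theorem dense_range_of_preimage_eq_empty {H : GTS Y} {f : X → Y}
    (h : ∀ V ∈ H.Op, f ⁻¹' V = ∅ → V = ∅) : @Dense Y H.topology (range f) := by
  let _ := H.topology
  refine H.isTopologicalBasis_Op.dense_iff.2 fun V hV hne => ?_
  by_contra hcon
  refine hne.ne_empty (h V hV ?_)
  refine eq_empty_iff_forall_notMem.2 fun x hx => hcon ⟨f x, hx, x, rfl⟩

/-! ### The remainder of a closed set -/

/-- The trace `ψ⁻¹([A])` on `K` of the closed set `A ∪ ψ⁻¹([A])` of `X ∪_ψ K`. -/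
def rem {G : GTS X} {H : GTS K} (ψ : H.clLattice ≃o G.RemLattice) (A : G.clLattice) :
    H.clLattice :=
  ψ.symm (G.remClass A)

section Rem

variable {G : GTS X} {H : GTS K} (ψ : H.clLattice ≃o G.RemLattice)

@[simp]
theorem inl_mem_glueSet {A : G.clLattice} {x : X} :
    Sum.inl x ∈ glueSet ψ A ↔ x ∈ (A : Set X) := by
  simp [glueSet]

@[simp]
theorem inr_mem_glueSet {A : G.clLattice} {k : K} :
    Sum.inr k ∈ glueSet ψ A ↔ k ∈ (rem ψ A : Set K) := by
  simp [glueSet, rem]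

/-- Every closed set of `K` is the remainder of a closed set of `X`. -/
theorem rem_surjective : Function.Surjective (rem ψ) := by
  intro C
  obtain ⟨A, hA⟩ := Quot.exists_rep (ψ C)
  exact ⟨A, by rw [rem, remClass, hA, ψ.symm_apply_apply]⟩

theorem glueSet_subset_glueSet {A B : G.clLattice} (h : (A : Set X) ⊆ B) :
    glueSet ψ A ⊆ glueSet ψ B := by
  rw [← sup_eq_right.2 (show A ≤ B from h), glueSet_sup]
  exact subset_union_left

theorem rem_eq_rem {A B : G.clLattice} (h : G.remRel A B) : rem ψ A = rem ψ B :=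
  congrArg ψ.symm (Quot.sound h)

theorem isCompact_of_rem_eq_empty (hl : G.TopLocallyCompact) {A : G.clLattice}
    (h : (rem ψ A : Set K) = ∅) : @IsCompact X G.topology (A : Set X) := by
  have h0 : (rem ψ ⟨∅, G.empty_mem_Cl⟩ : Set K) = ∅ :=
    eq_empty_iff_forall_notMem.2 fun k hk => by
      rw [← inr_mem_glueSet, glueSet_empty] at hk
      exact hk
  have he : G.remClass A = G.remClass ⟨∅, G.empty_mem_Cl⟩ :=
    ψ.symm.injective (Subtype.ext (h.trans h0.symm))
  have hr : G.remRel A ⟨∅, G.empty_mem_Cl⟩ :=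
    (G.remRel_equivalence hl).eqvGen_iff.1 (Quot.eqvGen_exact he)
  exact hr A A.2 fun x hx => Or.inl ⟨hx, notMem_empty x⟩

/-- Removing a relatively compact open set does not change the remainder. -/
theorem rem_inter_compl {A : G.clLattice} {U E : Set X} (hU : U ∈ G.Op)
    (hE : @IsCompact X G.topology E) (hUE : U ⊆ E) :
    rem ψ (A ⊓ ⟨Uᶜ, G.compl_mem_Cl hU⟩) = rem ψ A := by
  let _ := G.topology
  refine rem_eq_rem ψ fun D hD hs => ?_
  refine hE.of_isClosed_subset (G.isClosed_of_mem_Cl hD) fun x hx => hUE ?_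
  by_contra hxU
  rcases hs hx with ⟨h1, h2⟩ | ⟨h1, h2⟩
  · exact h2 h1.1
  · exact h2 ⟨h1, hxU⟩

/-! ### The space `X ∪_ψ K` -/

theorem isSmall_glue : (glue ψ).IsSmall := rfl

theorem mem_glueOp_iff {U : Set (X ⊕ K)} :
    U ∈ (glue ψ).Op ↔ ∃ A : G.clLattice, U = (glueSet ψ A)ᶜ := by
  constructor
  · rintro ⟨A, hA⟩
    exact ⟨A, by rw [hA, compl_compl]⟩
  · rintro ⟨A, rfl⟩
    exact ⟨A, (compl_compl _).symm⟩

theorem glueSet_compl_mem (A : G.clLattice) : (glueSet ψ A)ᶜ ∈ (glue ψ).Op :=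
  (mem_glueOp_iff ψ).2 ⟨A, rfl⟩

theorem preimage_inl_glueSet (A : G.clLattice) : Sum.inl ⁻¹' glueSet ψ A = (A : Set X) := by
  ext; simp

theorem preimage_inr_glueSet (A : G.clLattice) : Sum.inr ⁻¹' glueSet ψ A = (rem ψ A : Set K) := by
  ext; simp

theorem preimage_inl_mem : ∀ V ∈ (glue ψ).Op, Sum.inl ⁻¹' V ∈ G.Op := by
  intro V hV
  obtain ⟨A, rfl⟩ := (mem_glueOp_iff ψ).1 hV
  rw [preimage_compl, preimage_inl_glueSet]
  exact A.2

theorem preimage_inr_mem : ∀ V ∈ (glue ψ).Op, Sum.inr ⁻¹' V ∈ H.Op := by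
  intro V hV
  obtain ⟨A, rfl⟩ := (mem_glueOp_iff ψ).1 hV
  rw [preimage_compl, preimage_inr_glueSet]
  exact (rem ψ A).2

theorem exists_preimage_inl_eq : ∀ U ∈ G.Op, ∃ V ∈ (glue ψ).Op, Sum.inl ⁻¹' V = U := by
  intro U hU
  refine ⟨_, glueSet_compl_mem ψ ⟨Uᶜ, G.compl_mem_Cl hU⟩, ?_⟩
  rw [preimage_compl, preimage_inl_glueSet, compl_compl]

theorem exists_preimage_inr_eq : ∀ U ∈ H.Op, ∃ V ∈ (glue ψ).Op, Sum.inr ⁻¹' V = U := by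
  intro U hU
  obtain ⟨A, hA⟩ := rem_surjective ψ ⟨Uᶜ, H.compl_mem_Cl hU⟩
  refine ⟨_, glueSet_compl_mem ψ A, ?_⟩
  rw [preimage_compl, preimage_inr_glueSet, hA, compl_compl]

theorem glueOp_subset_of_preimage_inl_subset : ∀ V ∈ (glue ψ).Op, ∀ V' ∈ (glue ψ).Op,
    (Sum.inl ⁻¹' V : Set X) ⊆ Sum.inl ⁻¹' V' → V ⊆ V' := by
  intro V hV V' hV' h
  obtain ⟨A, rfl⟩ := (mem_glueOp_iff ψ).1 hV
  obtain ⟨B, rfl⟩ := (mem_glueOp_iff ψ).1 hV'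
  rw [preimage_compl, preimage_compl, preimage_inl_glueSet, preimage_inl_glueSet,
    compl_subset_compl] at h
  exact compl_subset_compl.2 (glueSet_subset_glueSet ψ h)

/-- A nonempty family of closed sets of `X`, stable under intersections and without empty members,
yields a family of closed sets `A ∪ ψ⁻¹([A])` with a common point. -/
theorem exists_mem_glueSet (hl : G.TopLocallyCompact) (hK : H.TopCompact)
    {S : Set G.clLattice} (hne : S.Nonempty) (hinf : ∀ A ∈ S, ∀ B ∈ S, A ⊓ B ∈ S)
    (h0 : ∀ A ∈ S, (A : Set X).Nonempty) : ∃ y, ∀ A ∈ S, y ∈ glueSet ψ A := by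
  let _ := G.topology
  let _ := H.topology
  have : CompactSpace K := hK
  have : Nonempty S := hne.to_subtype
  by_cases hc : ∃ A ∈ S, IsCompact (A : Set X)
  · obtain ⟨A, hA, hcA⟩ := hc
    have hdir : Directed (· ⊇ ·) fun B : S => ((A ⊓ B.1 : G.clLattice) : Set X) := by
      intro B C
      refine ⟨⟨B.1 ⊓ C.1, hinf _ B.2 _ C.2⟩, ?_, ?_⟩
      · exact fun x hx => ⟨hx.1, hx.2.1⟩
      · exact fun x hx => ⟨hx.1, hx.2.2⟩
    obtain ⟨x, hx⟩ := IsCompact.nonempty_iInter_of_directed_nonempty_isCompact_isClosed _ hdir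
      (fun B => h0 _ (hinf _ hA _ B.2))
      (fun B => hcA.of_isClosed_subset (G.isClosed_of_mem_Cl (A ⊓ B.1).2) inter_subset_left)
      (fun B => G.isClosed_of_mem_Cl (A ⊓ B.1).2)
    exact ⟨Sum.inl x, fun B hB => (inl_mem_glueSet ψ).2 (mem_iInter.1 hx ⟨B, hB⟩).2⟩
  · have hdir : Directed (· ⊇ ·) fun B : S => (rem ψ B.1 : Set K) := by
      intro B C
      refine ⟨⟨B.1 ⊓ C.1, hinf _ B.2 _ C.2⟩, ?_, ?_⟩
      · intro k hk
        rw [← inr_mem_glueSet, glueSet_inf] at hk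
        exact (inr_mem_glueSet ψ).1 hk.1
      · intro k hk
        rw [← inr_mem_glueSet, glueSet_inf] at hk
        exact (inr_mem_glueSet ψ).1 hk.2
    obtain ⟨k, hk⟩ := IsCompact.nonempty_iInter_of_directed_nonempty_isCompact_isClosed _ hdir
      (fun B => nonempty_iff_ne_empty.2 fun h =>
        hc ⟨B.1, B.2, isCompact_of_rem_eq_empty ψ hl h⟩)
      (fun B => (H.isClosed_of_mem_Cl (rem ψ B.1).2).isCompact)
      (fun B => H.isClosed_of_mem_Cl (rem ψ B.1).2)
    exact ⟨Sum.inr k, fun B hB => (inr_mem_glueSet ψ).2 (mem_iInter.1 hk ⟨B, hB⟩)⟩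

theorem topCompact_glue (hl : G.TopLocallyCompact) (hK : H.TopCompact) :
    (glue ψ).TopCompact := by
  let _ := (glue ψ).topology
  refine ⟨isCompact_generateFrom rfl fun 𝒰 h𝒰 hcov => ?_⟩
  by_contra! hcon
  -- The closed sets whose complements are finite unions from `𝒰`.
  let S : Set G.clLattice := {A | ∃ ℱ ⊆ 𝒰, ℱ.Finite ∧ (glueSet ψ A)ᶜ = ⋃₀ ℱ}
  obtain ⟨y, hy⟩ := exists_mem_glueSet ψ hl hK (S := S)
    ⟨⟨univ, G.univ_mem_Cl⟩, ∅, empty_subset _, finite_empty, by rw [glueSet_univ]; simp⟩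
    (by
      rintro A ⟨ℱ, hs, hf, he⟩ B ⟨ℱ', hs', hf', he'⟩
      refine ⟨ℱ ∪ ℱ', union_subset hs hs', hf.union hf', ?_⟩
      rw [glueSet_inf, compl_inter, he, he', sUnion_union])
    (by
      rintro A ⟨ℱ, hs, hf, he⟩
      by_contra hA
      have hA' : A = ⟨∅, G.empty_mem_Cl⟩ := Subtype.ext (not_nonempty_iff_eq_empty.1 hA)
      rw [hA', glueSet_empty, compl_empty] at he
      exact hcon ℱ hs hf he.subset)
  obtain ⟨U, hU, hyU⟩ := hcov (mem_univ y)
  obtain ⟨A, rfl⟩ := (mem_glueOp_iff ψ).1 (h𝒰 hU)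
  exact hyU (hy A ⟨{(glueSet ψ A)ᶜ}, singleton_subset_iff.2 hU, finite_singleton _, by simp⟩)

/-- The set `A ∪ ψ⁻¹([A])` is the closure of `A`, because a basic closed set `B ∪ ψ⁻¹([B])` that
contains `A` contains `ψ⁻¹([A])` as well. -/
theorem closure_image_inl (A : G.clLattice) :
    @closure _ (glue ψ).topology (Sum.inl '' (A : Set X)) = glueSet ψ A := by
  let _ := (glue ψ).topology
  apply Subset.antisymm
  · refine closure_minimal ?_ ((glue ψ).isClosed_of_mem_Cl (glueSet_compl_mem ψ A))
    exact subset_union_left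
  · intro y hy
    refine (glue ψ).isTopologicalBasis_Op.mem_closure_iff.2 fun V hV hyV => ?_
    obtain ⟨B, rfl⟩ := (mem_glueOp_iff ψ).1 hV
    by_contra hcon
    refine hyV (glueSet_subset_glueSet ψ (fun x hx => ?_) hy)
    by_contra hxB
    exact hcon ⟨Sum.inl x, fun h => hxB ((inl_mem_glueSet ψ).1 h), x, hx, rfl⟩

theorem isStrictCompactification_glue (hG : G.IsSmall) (hl : G.TopLocallyCompact)
    (hK : H.TopCompact) : IsStrictCompactification G (glue ψ) Sum.inl where
  topCompact := topCompact_glue ψ hl hK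
  isStrictEmbedding := hG.isStrictEmbedding (isSmall_glue ψ) Sum.inl_injective
    (preimage_inl_mem ψ) (exists_preimage_inl_eq ψ)
  dense := dense_range_of_preimage_eq_empty fun V hV h =>
    subset_empty_iff.1 (glueOp_subset_of_preimage_inl_subset ψ V hV ∅ (glue ψ).empty_mem
      (by rw [h]; exact empty_subset _))

/-! ### Points of `X ∪_ψ K` as ultrafilters of closed sets -/

theorem isFilterIn_glue (y : X ⊕ K) :
    IsFilterIn G.Cl {A | ∃ hA : A ∈ G.Cl, y ∈ glueSet ψ ⟨A, hA⟩} where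
  subset := fun _ h => h.1
  nonempty := ⟨univ, G.univ_mem_Cl, by rw [glueSet_univ]; trivial⟩
  empty_notMem := by
    rintro ⟨_, h⟩
    rw [glueSet_empty] at h
    exact h
  inter_mem := by
    rintro A ⟨hA, h⟩ B ⟨hB, h'⟩
    refine ⟨G.inter_mem_Cl hA hB, ?_⟩
    have := glueSet_inf ψ ⟨A, hA⟩ ⟨B, hB⟩
    exact this.symm ▸ ⟨h, h'⟩
  mem_of_superset := by
    rintro A ⟨hA, h⟩ B hB hAB
    exact ⟨hB, glueSet_subset_glueSet ψ hAB h⟩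

theorem exists_mem_Cl_disjoint (hH : H.WeaklyHausdorff) (hK : H.TopCompact) {k : K} {B : Set K}
    (hB : B ∈ H.Cl) (hk : k ∉ B) : ∃ C ∈ H.Cl, k ∈ C ∧ Disjoint C B := by
  let _ := H.topology
  have : CompactSpace K := hK
  have : T2Space K := hH
  have hBc : IsCompact B := (H.isClosed_of_mem_Cl hB).isCompact
  obtain ⟨U, hU, hBU, hkU⟩ : ∃ U ∈ H.Op, B ⊆ U ∧ k ∉ U := by
    refine hBc.induction_on (p := fun s => ∃ U ∈ H.Op, s ⊆ U ∧ k ∉ U) ?_ ?_ ?_ ?_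
    · exact ⟨∅, H.empty_mem, Subset.rfl, notMem_empty k⟩
    · rintro s t hst ⟨U, hU, h, hkU⟩
      exact ⟨U, hU, hst.trans h, hkU⟩
    · rintro s t ⟨U, hU, h, hkU⟩ ⟨V, hV, h', hkV⟩
      exact ⟨U ∪ V, H.union_mem _ hU _ hV, union_subset_union h h', fun hk => hk.elim hkU hkV⟩
    · intro x hx
      have hxk : x ∈ ({k}ᶜ : Set K) := fun h => hk (h ▸ hx)
      obtain ⟨U, hU, hxU, hUk⟩ :=
        H.isTopologicalBasis_Op.exists_subset_of_mem_open hxk isOpen_compl_singleton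
      exact ⟨U, mem_nhdsWithin_of_mem_nhds ((H.isOpen_of_mem_Op hU).mem_nhds hxU), U, hU,
        Subset.rfl, fun hkU => hUk hkU rfl⟩
  exact ⟨Uᶜ, H.compl_mem_Cl hU, hkU, disjoint_left.2 fun x hx hxB => hx (hBU hxB)⟩

/-- If the remainder of `B` misses the point `k`, then some closed set whose remainder contains `k`
is disjoint from `B` itself, and not only near infinity. -/
theorem exists_mem_rem_disjoint (hl : G.TopLocallyCompact) (hH : H.WeaklyHausdorff)
    (hK : H.TopCompact) {k : K} {B : G.clLattice} (hk : k ∉ (rem ψ B : Set K)) :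
    ∃ A : G.clLattice, k ∈ (rem ψ A : Set K) ∧ Disjoint (A : Set X) B := by
  obtain ⟨C, hC, hkC, hCB⟩ := exists_mem_Cl_disjoint hH hK (rem ψ B).2 hk
  obtain ⟨A, hA⟩ := rem_surjective ψ ⟨C, hC⟩
  have he : (rem ψ (A ⊓ B) : Set K) = ∅ := by
    rw [← preimage_inr_glueSet, glueSet_inf, preimage_inter, preimage_inr_glueSet,
      preimage_inr_glueSet, hA]
    exact hCB.inter_eq
  obtain ⟨U, hU, hABU, E, hE, hUE⟩ :=
    G.exists_op_between hl _ (isCompact_of_rem_eq_empty ψ hl he)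
  refine ⟨A ⊓ ⟨Uᶜ, G.compl_mem_Cl hU⟩, ?_, ?_⟩
  · rw [rem_inter_compl ψ hU hE hUE, hA]
    exact hkC
  · exact disjoint_left.2 fun x hx hxB => hx.2 (hABU ⟨hx.1, hxB⟩)

theorem isUltrafilterIn_glue_inr (hl : G.TopLocallyCompact) (hH : H.WeaklyHausdorff)
    (hK : H.TopCompact) (k : K) :
    IsUltrafilterIn G.Cl {A | ∃ hA : A ∈ G.Cl, Sum.inr k ∈ glueSet ψ ⟨A, hA⟩} where
  toIsFilterIn := isFilterIn_glue ψ (Sum.inr k)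
  maximal := by
    intro q hq hpq
    refine Subset.antisymm (fun B hB => ⟨hq.subset hB, ?_⟩) hpq
    by_contra hk
    rw [inr_mem_glueSet] at hk
    obtain ⟨A, hkA, hAB⟩ := exists_mem_rem_disjoint ψ hl hH hK hk
    have h0 := hq.inter_mem _ (hpq ⟨A.2, (inr_mem_glueSet ψ).2 hkA⟩) _ hB
    exact hq.empty_notMem (hAB.inter_eq ▸ h0)

/-- A point of `X` and a point of `K` are separated by the complement of a relatively compact open
neighbourhood of the former. -/
theorem exists_inr_mem_glueSet_inl_notMem (hl : G.TopLocallyCompact) (x : X) (k : K) :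
    ∃ A : G.clLattice, Sum.inr k ∈ glueSet ψ A ∧ Sum.inl x ∉ glueSet ψ A := by
  let _ := G.topology
  obtain ⟨U, hU, hxU, E, hE, hUE⟩ := G.exists_op_between hl {x} isCompact_singleton
  refine ⟨⟨univ, G.univ_mem_Cl⟩ ⊓ ⟨Uᶜ, G.compl_mem_Cl hU⟩, ?_, ?_⟩
  · rw [inr_mem_glueSet, rem_inter_compl ψ hU hE hUE, ← inr_mem_glueSet, glueSet_univ]
    trivial
  · rw [inl_mem_glueSet]
    exact fun h => h.2 (hxU rfl)

theorem eq_of_forall_mem_glueSet_iff (hn : G.WeaklyNormal) (hl : G.TopLocallyCompact)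
    (hH : H.WeaklyHausdorff) {y z : X ⊕ K}
    (h : ∀ A : G.clLattice, y ∈ glueSet ψ A ↔ z ∈ glueSet ψ A) : y = z := by
  rcases y with x | k <;> rcases z with x' | k'
  · by_contra hne
    obtain ⟨U, hU, V, -, hxU, hxV, hd⟩ := hn {x} {x'} (Or.inl ⟨x, rfl⟩) (Or.inl ⟨x', rfl⟩)
      (disjoint_singleton.2 fun e => hne (congrArg _ e))
    have := h ⟨Uᶜ, G.compl_mem_Cl hU⟩
    rw [inl_mem_glueSet, inl_mem_glueSet] at this
    exact this.2 (disjoint_right.1 hd (hxV rfl)) (hxU rfl)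
  · obtain ⟨A, h1, h2⟩ := exists_inr_mem_glueSet_inl_notMem ψ hl x k'
    exact absurd ((h A).2 h1) h2
  · obtain ⟨A, h1, h2⟩ := exists_inr_mem_glueSet_inl_notMem ψ hl x' k
    exact absurd ((h A).1 h1) h2
  · by_contra hne
    let _ := H.topology
    have : T2Space K := hH
    have hkk : k ∈ ({k'}ᶜ : Set K) := fun e => hne (congrArg _ e)
    obtain ⟨U, hU, hkU, hUk⟩ :=
      H.isTopologicalBasis_Op.exists_subset_of_mem_open hkk isOpen_compl_singleton
    obtain ⟨A, hA⟩ := rem_surjective ψ ⟨Uᶜ, H.compl_mem_Cl hU⟩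
    have := h A
    rw [inr_mem_glueSet, inr_mem_glueSet, hA] at this
    exact this.2 (fun hk' => hUk hk' rfl) hkU

/-- The ultrafilter of all closed sets `A` such that `A ∪ ψ⁻¹([A])` contains a given point. -/
def glueUltrafilter (hn : G.WeaklyNormal) (hl : G.TopLocallyCompact) (hH : H.WeaklyHausdorff)
    (hK : H.TopCompact) : X ⊕ K → WallmanSpace G.Cl
  | Sum.inl x => G.wallmanMap hn x
  | Sum.inr k => ⟨_, isUltrafilterIn_glue_inr ψ hl hH hK k⟩

section Wallman

variable (hn : G.WeaklyNormal) (hl : G.TopLocallyCompact) (hH : H.WeaklyHausdorff)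
  (hK : H.TopCompact)

theorem mem_glueUltrafilter {y : X ⊕ K} (A : G.clLattice) :
    (A : Set X) ∈ (glueUltrafilter ψ hn hl hH hK y).1 ↔ y ∈ glueSet ψ A := by
  rcases y with x | k
  · rw [inl_mem_glueSet]
    exact ⟨fun h => h.2, fun h => ⟨A.2, h⟩⟩
  · exact ⟨fun ⟨_, h⟩ => h, fun h => ⟨A.2, h⟩⟩

theorem glueUltrafilter_bijective : Function.Bijective (glueUltrafilter ψ hn hl hH hK) := by
  constructor
  · intro y z hyz
    refine eq_of_forall_mem_glueSet_iff ψ hn hl hH fun A => ?_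
    rw [← mem_glueUltrafilter ψ hn hl hH hK, hyz, mem_glueUltrafilter]
  · intro p
    have hp := p.2
    obtain ⟨y, hy⟩ := exists_mem_glueSet ψ hl hK (S := {A | (A : Set X) ∈ p.1})
      (let ⟨A, hA⟩ := hp.nonempty; ⟨⟨A, hp.subset hA⟩, hA⟩)
      (fun A hA B hB => hp.inter_mem _ hA _ hB)
      (fun A hA => nonempty_iff_ne_empty.2 fun h => hp.empty_notMem (h ▸ hA))
    refine ⟨y, Subtype.ext (hp.maximal _ (glueUltrafilter ψ hn hl hH hK y).2.toIsFilterIn ?_)⟩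
    exact fun A hA => (mem_glueUltrafilter ψ hn hl hH hK ⟨A, hp.subset hA⟩).2 (hy _ hA)

/-- The identification of `X ∪_ψ K` with the Wallman space of `X`. -/
noncomputable def glueEquiv : X ⊕ K ≃ WallmanSpace G.Cl :=
  Equiv.ofBijective _ (glueUltrafilter_bijective ψ hn hl hH hK)

theorem preimage_glueEquiv_basic (A : G.clLattice) :
    glueEquiv ψ hn hl hH hK ⁻¹' WallmanSpace.basic G.Cl A = glueSet ψ A :=
  Set.ext fun _ => mem_glueUltrafilter ψ hn hl hH hK A

/-- The topology of `X ∪_ψ K` is induced by `glueEquiv`, which is thus a homeomorphism. -/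
theorem isInducing_glueEquiv :
    @Topology.IsInducing _ _ (glue ψ).topology _ (glueEquiv ψ hn hl hH hK) := by
  let _ := (glue ψ).topology
  refine ⟨?_⟩
  rw [WallmanSpace.instTopologicalSpace, induced_generateFrom_eq]
  refine congrArg TopologicalSpace.generateFrom (Set.ext fun U => ?_)
  constructor
  · intro hU
    obtain ⟨A, rfl⟩ := (mem_glueOp_iff ψ).1 hU
    refine ⟨_, ⟨A, A.2, rfl⟩, ?_⟩
    rw [preimage_compl, preimage_glueEquiv_basic]
  · rintro ⟨_, ⟨A, hA, rfl⟩, rfl⟩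
    rw [preimage_compl, preimage_glueEquiv_basic ψ hn hl hH hK ⟨A, hA⟩]
    exact glueSet_compl_mem ψ _

include ψ hl hH hK in
/-- The closure of a closed set `A` of `X` in the Wallman space consists of the ultrafilters that
contain `A`. -/
theorem closure_image_wallmanMap (A : G.clLattice) :
    closure (G.wallmanMap hn '' (A : Set X)) = WallmanSpace.basic G.Cl A := by
  let _ := (glue ψ).topology
  have hi := isInducing_glueEquiv ψ hn hl hH hK
  have h : G.wallmanMap hn '' (A : Set X) =
      glueEquiv ψ hn hl hH hK '' (Sum.inl '' (A : Set X)) := by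
    rw [image_image]; rfl
  apply preimage_injective.2 (glueEquiv ψ hn hl hH hK).surjective
  rw [preimage_glueEquiv_basic, h, ← hi.closure_eq_preimage_closure_image, closure_image_inl]

theorem mem_wallmanOp_iff {V : Set (WallmanSpace G.Cl)} :
    V ∈ G.wallmanOp (G.wallmanMap hn) ↔ glueEquiv ψ hn hl hH hK ⁻¹' V ∈ (glue ψ).Op := by
  rw [mem_glueOp_iff]
  constructor
  · rintro ⟨U, hU, rfl⟩
    refine ⟨⟨Uᶜ, G.compl_mem_Cl hU⟩, ?_⟩
    rw [Ex, closure_image_wallmanMap ψ hn hl hH hK ⟨Uᶜ, G.compl_mem_Cl hU⟩, preimage_compl,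
      preimage_glueEquiv_basic]
  · rintro ⟨A, hA⟩
    refine ⟨(A : Set X)ᶜ, A.2, preimage_injective.2 (glueEquiv ψ hn hl hH hK).surjective ?_⟩
    rw [hA, Ex, compl_compl, closure_image_wallmanMap ψ hn hl hH hK, preimage_compl,
      preimage_glueEquiv_basic]

/-- The generalized topology of `X ∪_ψ K`, carried over to the Wallman space. -/
noncomputable def wallmanGTS : GTS (WallmanSpace G.Cl) :=
  ofRing {V | glueEquiv ψ hn hl hH hK ⁻¹' V ∈ (glue ψ).Op} (glue ψ).empty_mem (glue ψ).univ_mem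
    (fun _ hU _ hV => (glue ψ).union_mem _ hU _ hV)
    (fun _ hU _ hV => (glue ψ).inter_mem _ hU _ hV)

theorem isSmall_wallmanGTS : (wallmanGTS ψ hn hl hH hK).IsSmall := rfl

theorem mem_wallmanGTS_Op {V : Set (WallmanSpace G.Cl)} :
    V ∈ (wallmanGTS ψ hn hl hH hK).Op ↔ glueEquiv ψ hn hl hH hK ⁻¹' V ∈ (glue ψ).Op := Iff.rfl

theorem wallmanGTS_Op_eq : (wallmanGTS ψ hn hl hH hK).Op = G.wallmanOp (G.wallmanMap hn) :=
  Set.ext fun _ => (mem_wallmanOp_iff ψ hn hl hH hK).symm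

theorem preimage_wallmanMap_mem : ∀ V ∈ (wallmanGTS ψ hn hl hH hK).Op,
    G.wallmanMap hn ⁻¹' V ∈ G.Op :=
  fun _ hV => preimage_inl_mem ψ _ hV

theorem exists_preimage_wallmanMap_eq : ∀ U ∈ G.Op, ∃ V ∈ (wallmanGTS ψ hn hl hH hK).Op,
    G.wallmanMap hn ⁻¹' V = U := by
  intro U hU
  obtain ⟨V, hV, rfl⟩ := exists_preimage_inl_eq ψ U hU
  have h : glueEquiv ψ hn hl hH hK ⁻¹' ((glueEquiv ψ hn hl hH hK).symm ⁻¹' V) = V :=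
    (glueEquiv ψ hn hl hH hK).preimage_symm_preimage V
  refine ⟨(glueEquiv ψ hn hl hH hK).symm ⁻¹' V, ?_, ?_⟩
  · rw [mem_wallmanGTS_Op, h]
    exact hV
  · exact congrArg (Sum.inl ⁻¹' ·) h

theorem wallmanGTS_subset_of_preimage_subset : ∀ V ∈ (wallmanGTS ψ hn hl hH hK).Op,
    ∀ V' ∈ (wallmanGTS ψ hn hl hH hK).Op,
    G.wallmanMap hn ⁻¹' V ⊆ G.wallmanMap hn ⁻¹' V' → V ⊆ V' := by
  intro V hV V' hV' h
  rw [← (glueEquiv ψ hn hl hH hK).preimage_subset]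
  exact glueOp_subset_of_preimage_inl_subset ψ _ hV _ hV' h

theorem strictlyContinuous_glueEquiv :
    StrictlyContinuous (glue ψ) (wallmanGTS ψ hn hl hH hK) (glueEquiv ψ hn hl hH hK) :=
  (isSmall_glue ψ).strictlyContinuous (isSmall_wallmanGTS ψ hn hl hH hK) fun _ h => h

theorem strictlyContinuous_glueEquiv_symm :
    StrictlyContinuous (wallmanGTS ψ hn hl hH hK) (glue ψ) (glueEquiv ψ hn hl hH hK).symm :=
  (isSmall_wallmanGTS ψ hn hl hH hK).strictlyContinuous (isSmall_glue ψ) fun V hV => by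
    rw [mem_wallmanGTS_Op, Equiv.preimage_symm_preimage]
    exact hV

theorem topology_wallmanGTS :
    (wallmanGTS ψ hn hl hH hK).topology = (inferInstance : TopologicalSpace (WallmanSpace G.Cl)) := by
  refine congrArg TopologicalSpace.generateFrom (Set.ext fun V => ?_)
  rw [wallmanGTS_Op_eq]
  constructor
  · rintro ⟨U, hU, rfl⟩
    refine ⟨Uᶜ, G.compl_mem_Cl hU, ?_⟩
    rw [Ex, closure_image_wallmanMap ψ hn hl hH hK ⟨Uᶜ, G.compl_mem_Cl hU⟩]
  · rintro ⟨A, hA, rfl⟩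
    refine ⟨Aᶜ, hA, ?_⟩
    rw [Ex, compl_compl, closure_image_wallmanMap ψ hn hl hH hK ⟨A, hA⟩]

include ψ hn hl hH hK in
theorem compactSpace_wallmanSpace : CompactSpace (WallmanSpace G.Cl) := by
  let _ := (glue ψ).topology
  have : CompactSpace (X ⊕ K) := topCompact_glue ψ hl hK
  exact (glueEquiv ψ hn hl hH hK).surjective.compactSpace
    (isInducing_glueEquiv ψ hn hl hH hK).continuous

theorem isWallmanStrictCompactification_wallmanGTS (hG : G.IsSmall) :
    G.IsWallmanStrictCompactification hn (wallmanGTS ψ hn hl hH hK) where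
  compact := compactSpace_wallmanSpace ψ hn hl hH hK
  op_eq := wallmanGTS_Op_eq ψ hn hl hH hK
  cov_eq := by
    have hW := isSmall_wallmanGTS ψ hn hl hH hK
    ext 𝒱
    constructor
    · intro h
      have hs := (wallmanGTS ψ hn hl hH hK).cov_subset _ h
      refine ⟨⟨fun V hV => ⟨?_, preimage_wallmanMap_mem ψ hn hl hH hK V (hs hV)⟩,
        hG.strictlyContinuous hW (preimage_wallmanMap_mem ψ hn hl hH hK) 𝒱 h⟩,
        wallmanGTS_Op_eq ψ hn hl hH hK ▸ hs⟩
      have ho := isOpen_of_mem_Op _ (hs hV)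
      rwa [topology_wallmanGTS] at ho
    · rintro ⟨⟨-, hc⟩, hs⟩
      rw [← wallmanGTS_Op_eq ψ hn hl hH hK] at hs
      exact hG.mem_cov_of_preFamily hW (wallmanGTS_subset_of_preimage_subset ψ hn hl hH hK) hs hc

theorem isStrictCompactification_wallmanGTS (hG : G.IsSmall) :
    IsStrictCompactification G (wallmanGTS ψ hn hl hH hK) (G.wallmanMap hn) where
  topCompact := by
    rw [TopCompact, topology_wallmanGTS]
    exact compactSpace_wallmanSpace ψ hn hl hH hK
  isStrictEmbedding := hG.isStrictEmbedding (isSmall_wallmanGTS ψ hn hl hH hK)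
    (fun _ _ h => Sum.inl_injective ((glueEquiv ψ hn hl hH hK).injective h))
    (preimage_wallmanMap_mem ψ hn hl hH hK) (exists_preimage_wallmanMap_eq ψ hn hl hH hK)
  dense := dense_range_of_preimage_eq_empty fun V hV h =>
    subset_empty_iff.1 (wallmanGTS_subset_of_preimage_subset ψ hn hl hH hK V hV ∅
      (wallmanGTS ψ hn hl hH hK).empty_mem (by rw [h]; exact empty_subset _))

end Wallman

end Rem

end GTS

theorem theorem6p6 {X : Type*} {K : Type*} (G : GTS X) (H : GTS K)
    (hGsmall : G.IsSmall) (hGnormal : G.WeaklyNormal) (hGnoncompact : ¬ G.TopCompact)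
    (hGloc : G.TopLocallyCompact)
    (hHsmall : H.IsSmall) (hHhaus : H.WeaklyHausdorff) (hHcompact : H.TopCompact)
    (ψ : H.clLattice ≃o G.RemLattice) :
    GTS.IsStrictCompactification G (GTS.glue ψ) Sum.inl ∧
    (∃ W : GTS (WallmanSpace G.Cl),
      G.IsWallmanStrictCompactification hGnormal W ∧
      GTS.IsStrictCompactification G W (G.wallmanMap hGnormal) ∧
      GTS.StrictlyEquivalent (GTS.glue ψ) Sum.inl W (G.wallmanMap hGnormal)) ∧
    GTS.IsStrictSubspace H (GTS.glue ψ) Sum.inr := by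
  exact ⟨GTS.isStrictCompactification_glue ψ hGsmall hGloc hHcompact,
    ⟨GTS.wallmanGTS ψ hGnormal hGloc hHhaus hHcompact,
      GTS.isWallmanStrictCompactification_wallmanGTS ψ hGnormal hGloc hHhaus hHcompact hGsmall,
      GTS.isStrictCompactification_wallmanGTS ψ hGnormal hGloc hHhaus hHcompact hGsmall,
      GTS.glueEquiv ψ hGnormal hGloc hHhaus hHcompact,
      GTS.strictlyContinuous_glueEquiv ψ hGnormal hGloc hHhaus hHcompact,
      GTS.strictlyContinuous_glueEquiv_symm ψ hGnormal hGloc hHhaus hHcompact, rfl⟩,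
    hHsmall.isStrictSubspace (GTS.isSmall_glue ψ) Sum.inr_injective
      (GTS.preimage_inr_mem ψ) (GTS.exists_preimage_inr_eq ψ)⟩
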